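/- Consider second-order predicate logic with individual variables $x_i$ and, for every $n\ge 1$, variables $A^n_i$ for $n$-ary predicates ($i \geq 0$). Atomic formulas are $A^n_i x_{i_1}\cdots x_{i_n}$, $x_i=x_j$ and $A^n_i=A^n_j$; formulas are built from them with $\neg,\land,\lor,\to,\leftrightarrow$ and with $\forall$, $\exists$ over variables of both kinds, where a variable may be quantified only in a formula in which it is not already quantified. A predicate structure $\Sigma=(J_n)_{n\ge 0}$ consists of a non-empty set $J_0$ of individuals and, for every $n\ge 1$, a non-empty set $J_n$ of $n$-ary predicates on $J_0$. In $\Sigma$, individual variables range over $J_0$, variables for $n$-ary predicates range over $J_n$, and atomic formulas and connectives have their usual meaning; $\Sigma$ is a model of a formula if the formula is true in $\Sigma$ under all assignments (of individuals and predicates of $\Sigma$) to its free variables. A Henkin structure is a predicate structure that is a model of all comprehension axioms $\exists A^n_i\,\forall x_{1}\cdots\forall x_{n}\,(A^n_i x_{1}\cdots x_{n}\leftrightarrow H)$, where $n\ge 1$, $x_1,\dots,x_n$ are distinct individual variables that occur only free in the formula $H$, and $A^n_i$ does not occur in $H$ (other variables may occur free in $H$). Let $\exists!!\,y\,F(y)$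 abbreviate $\exists y\,F(y)\land\forall y_1\forall y_2\,(F(y_1)\land F(y_2)\to y_1=y_2)$. Let $AC^{1,1}$ be the sentence $$\forall A\,\forall R\,\exists S\,\bigl(\forall x\,(Ax\leftrightarrow\exists y\,Rxy)\to\forall x\,(Ax\to\exists!!\,y\,(Rxy\land Sxy))\bigr)$$ with $A$ unary and $R,S$ binary, and let $choice_*^1$ be the set of all formulas $$\forall C\,(H(C)\to\exists y\,Cy)\,\land\,\forall C_1\forall C_2\,\bigl(H(C_1)\land H(C_2)\land C_1\ne C_2\to\neg\exists y\,(C_1y\land C_2y)\bigr)\;\to\;\exists D\,\forall C\,\bigl(H(C)\to\exists!!\,y\,(Cy\land Dy)\bigr),$$ where $C,C_1,C_2,D$ are distinct variables for unary predicates and $H=H(C)$ is a formula in which $C$ occurs only free and in which $C_1,C_2,D$ do not occur (other variables may occur free in $H$). Then $choice_*^1$ is HPL-independent of $AC^{1,1}$, that is: 1. $AC^{1,1}$ does not HPL-entail $choice_*^1$: there are a formula in $choice_*^1$ and a Henkin structure that is a model of $AC^{1,1}$ but not of this formula. 2. $AC^{1,1}$ does not HPL-refute $choice_*^1$: there is a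 Henkin structure that is a model of $AC^{1,1}$ and of all formulas in $choice_*^1$. -/

import Mathlib

universe u

namespace HPL

/-- Expressions of the second-order language. The individual variable `x_i` is represented by
its index `i`. The predicate variable with indices `n` and `i` is the `i`-th variable for
predicates of arity `n + 1`, so that all arities are at least one. -/
inductive Formula : Type where
  /-- `A x_{v 0} ... x_{v n}` for the predicate variable `A` with indices `n`, `i` -/
  | app (n i : ℕ) (v : Fin (n + 1) → ℕ) : Formula
  | indEq (i j : ℕ) : Formula
  | predEq (n i j : ℕ) : Formula
  | neg (F : Formula) : Formula
  | and (F G : Formula) : Formula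
  | or (F G : Formula) : Formula
  | imp (F G : Formula) : Formula
  | iff (F G : Formula) : Formula
  | all (i : ℕ) (F : Formula) : Formula
  | ex (i : ℕ) (F : Formula) : Formula
  | allPred (n i : ℕ) (F : Formula) : Formula
  | exPred (n i : ℕ) (F : Formula) : Formula

namespace Formula

/-- The individual variable `x` is quantified somewhere in the formula. -/
def BindsInd (x : ℕ) : Formula → Prop
  | app _ _ _ => False
  | indEq _ _ => False
  | predEq _ _ _ => False
  | neg F => F.BindsInd x
  | and F G => F.BindsInd x ∨ G.BindsInd x
  | or F G => F.BindsInd x ∨ G.BindsInd x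
  | imp F G => F.BindsInd x ∨ G.BindsInd x
  | iff F G => F.BindsInd x ∨ G.BindsInd x
  | all i F => i = x ∨ F.BindsInd x
  | ex i F => i = x ∨ F.BindsInd x
  | allPred _ _ F => F.BindsInd x
  | exPred _ _ F => F.BindsInd x

/-- The predicate variable with indices `m`, `c` is quantified somewhere in the formula. -/
def BindsPred (m c : ℕ) : Formula → Prop
  | app _ _ _ => False
  | indEq _ _ => False
  | predEq _ _ _ => False
  | neg F => F.BindsPred m c
  | and F G => F.BindsPred m c ∨ G.BindsPred m c
  | or F G => F.BindsPred m c ∨ G.BindsPred m c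
  | imp F G => F.BindsPred m c ∨ G.BindsPred m c
  | iff F G => F.BindsPred m c ∨ G.BindsPred m c
  | all _ F => F.BindsPred m c
  | ex _ F => F.BindsPred m c
  | allPred n i F => (n = m ∧ i = c) ∨ F.BindsPred m c
  | exPred n i F => (n = m ∧ i = c) ∨ F.BindsPred m c

/-- The predicate variable with indices `m`, `c` occurs (free or bound) in the formula. -/
def OccursPred (m c : ℕ) : Formula → Prop
  | app n i _ => n = m ∧ i = c
  | indEq _ _ => False
  | predEq n i j => n = m ∧ (i = c ∨ j = c)
  | neg F => F.OccursPred m c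
  | and F G => F.OccursPred m c ∨ G.OccursPred m c
  | or F G => F.OccursPred m c ∨ G.OccursPred m c
  | imp F G => F.OccursPred m c ∨ G.OccursPred m c
  | iff F G => F.OccursPred m c ∨ G.OccursPred m c
  | all _ F => F.OccursPred m c
  | ex _ F => F.OccursPred m c
  | allPred n i F => (n = m ∧ i = c) ∨ F.OccursPred m c
  | exPred n i F => (n = m ∧ i = c) ∨ F.OccursPred m c

/-- The formulas of the language: a variable may only be quantified in a formula in which it
is not already quantified. -/
def WellFormed : Formula → Prop
  | app _ _ _ => True
  | indEq _ _ => True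
  | predEq _ _ _ => True
  | neg F => F.WellFormed
  | and F G => F.WellFormed ∧ G.WellFormed
  | or F G => F.WellFormed ∧ G.WellFormed
  | imp F G => F.WellFormed ∧ G.WellFormed
  | iff F G => F.WellFormed ∧ G.WellFormed
  | all i F => F.WellFormed ∧ ¬ F.BindsInd i
  | ex i F => F.WellFormed ∧ ¬ F.BindsInd i
  | allPred n i F => F.WellFormed ∧ ¬ F.BindsPred n i
  | exPred n i F => F.WellFormed ∧ ¬ F.BindsPred n i

/-- Substitution of the predicate variable `d` for the free occurrences of the predicate
variable `c`, both of arity `m + 1`. -/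
def substPred (m c d : ℕ) : Formula → Formula
  | app n i v => app n (if n = m ∧ i = c then d else i) v
  | indEq i j => indEq i j
  | predEq n i j =>
      predEq n (if n = m ∧ i = c then d else i) (if n = m ∧ j = c then d else j)
  | neg F => neg (F.substPred m c d)
  | and F G => and (F.substPred m c d) (G.substPred m c d)
  | or F G => or (F.substPred m c d) (G.substPred m c d)
  | imp F G => imp (F.substPred m c d) (G.substPred m c d)
  | iff F G => iff (F.substPred m c d) (G.substPred m c d)
  | all i F => all i (F.substPred m c d)
  | ex i F => ex i (F.substPred m c d)
  | allPred n i F => allPred n i (if n = m ∧ i = c then F else F.substPred m c d)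
  | exPred n i F => exPred n i (if n = m ∧ i = c then F else F.substPred m c d)

/-- `∀ x_{v 0} ... ∀ x_{v n} F` -/
def allTuple {n : ℕ} (v : Fin (n + 1) → ℕ) (F : Formula) : Formula :=
  (List.ofFn v).foldr all F

/-- "There is exactly one `y` with `F y`":
`∃ x_y F(x_y) ∧ ∀ x_y ∀ x_z (F(x_y) ∧ F(x_z) → x_y = x_z)`; here `F i` is the
formula that speaks about the variable `x_i`. -/
def exUnique (y z : ℕ) (F : ℕ → Formula) : Formula :=
  and (ex y (F y)) (all y (all z (imp (and (F y) (F z)) (indEq y z))))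

/-- `C x_y` for the `c`-th unary predicate variable `C` -/
def app₁ (c y : ℕ) : Formula := app 0 c ![y]

/-- `R x_y x_z` for the `r`-th binary predicate variable `R` -/
def app₂ (r y z : ℕ) : Formula := app 1 r ![y, z]

end Formula

/-- A predicate structure: a non-empty domain of individuals and, for every arity `n + 1`, a
non-empty domain of predicates of this arity on the individuals. -/
structure PredStructure where
  /-- the individuals -/
  Ind : Type u
  ind_nonempty : Nonempty Ind
  /-- the predicates of arity `n + 1` that belong to the structure -/
  Pred : (n : ℕ) → Set ((Fin (n + 1) → Ind) → Prop)
  pred_nonempty : ∀ n, (Pred n).Nonempty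

/-- Assignments in a predicate structure. -/
structure Assignment (M : PredStructure.{u}) where
  /-- the values of the individual variables -/
  ind : ℕ → M.Ind
  /-- the values of the predicate variables -/
  pred : (n : ℕ) → ℕ → M.Pred n

namespace Assignment

/-- The assignment that gives `x_i` the value `ξ` and otherwise agrees with `f`. -/
def setInd {M : PredStructure.{u}} (f : Assignment M) (i : ℕ) (ξ : M.Ind) : Assignment M where
  ind := Function.update f.ind i ξ
  pred := f.pred

/-- The assignment that gives the predicate variable with indices `n`, `i` the value `α` and
otherwise agrees with `f`. -/
def setPred {M : PredStructure.{u}} (f : Assignment M) (n i : ℕ) (α : M.Pred n) :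
    Assignment M where
  ind := f.ind
  pred := Function.update f.pred n (Function.update (f.pred n) i α)

end Assignment

namespace PredStructure

/-- The formula is true in the structure `M` under the assignment. -/
def Sat (M : PredStructure.{u}) : Assignment M → Formula → Prop
  | f, .app n i v => (f.pred n i).1 (fun k => f.ind (v k))
  | f, .indEq i j => f.ind i = f.ind j
  | f, .predEq n i j => f.pred n i = f.pred n j
  | f, .neg F => ¬ M.Sat f F
  | f, .and F G => M.Sat f F ∧ M.Sat f G
  | f, .or F G => M.Sat f F ∨ M.Sat f G
  | f, .imp F G => M.Sat f F → M.Sat f G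
  | f, .iff F G => (M.Sat f F ↔ M.Sat f G)
  | f, .all i F => ∀ ξ : M.Ind, M.Sat (f.setInd i ξ) F
  | f, .ex i F => ∃ ξ : M.Ind, M.Sat (f.setInd i ξ) F
  | f, .allPred n i F => ∀ α : M.Pred n, M.Sat (f.setPred n i α) F
  | f, .exPred n i F => ∃ α : M.Pred n, M.Sat (f.setPred n i α) F

/-- `M` is a model of the formula `F`: it is true in `M` under every assignment. -/
def Valid (M : PredStructure.{u}) (F : Formula) : Prop :=
  ∀ f : Assignment M, M.Sat f F

/-- `M` is a model of a set of formulas. -/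
def Models (M : PredStructure.{u}) (Γ : Set Formula) : Prop :=
  ∀ F ∈ Γ, M.Valid F

end PredStructure

/-- The axioms of comprehension `∃ A ∀ x_{v 0} ... ∀ x_{v n} (A x_{v 0} ... x_{v n} ↔ H)`, where
the pairwise distinct variables `x_{v 0}, ..., x_{v n}` occur only free in `H`, and where `A`
does not occur in `H`. Other variables may occur free in `H`. -/
def comprehension : Set Formula :=
  {F | ∃ (n a : ℕ) (v : Fin (n + 1) → ℕ) (H : Formula),
    H.WellFormed ∧ Function.Injective v ∧ (∀ k, ¬ H.BindsInd (v k)) ∧ ¬ H.OccursPred n a ∧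
    F = .exPred n a (.allTuple v (.iff (.app n a v) H))}

/-- Henkin structures of second order (Henkin-Asser structures). -/
def IsHenkin (M : PredStructure.{u}) : Prop := M.Models comprehension

/-- Semantic consequence in HPL: every Henkin structure that is a model of `Γ` is a model of `F`.
(The logical axioms, the axioms of identity and those of extensionality hold in all predicate
structures.) -/
def Entails (Γ : Set Formula) (F : Formula) : Prop :=
  ∀ M : PredStructure.{u}, IsHenkin M → M.Models Γ → M.Valid F

/-- The principle given by the set `Δ` of formulas is refuted by `Γ` in HPL: no Henkin structure
is a model of both. -/
def Refutes (Γ Δ : Set Formula) : Prop :=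
  ∀ M : PredStructure.{u}, IsHenkin M → M.Models Γ → ¬ M.Models Δ

/-- The principle given by the set `Δ` of formulas is HPL-independent of `Γ`: in HPL, it neither
follows from `Γ` nor is refuted by `Γ`. -/
def Independent (Δ Γ : Set Formula) : Prop :=
  ¬ (∀ F ∈ Δ, Entails.{u} Γ F) ∧ ¬ Refutes.{u} Γ Δ

/-- The Zermelo-Asser axiom for unary `A` and binary `R`, `S`:
`∀ A ∀ R ∃ S (∀ x (A x ↔ ∃ y R x y) → ∀ x (A x → ∃!! y (R x y ∧ S x y)))`. -/
def AC11 : Formula :=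
  .allPred 0 0 (.allPred 1 0 (.exPred 1 1 (.imp
    (.all 0 (.iff (.app₁ 0 0) (.ex 1 (.app₂ 0 0 1))))
    (.all 0 (.imp (.app₁ 0 0)
      (.exUnique 1 2 fun y => .and (.app₂ 0 0 y) (.app₂ 1 0 y)))))))

/-- Asser's axiom for the formula `H = H(C)` and unary predicate variables `C, C₁, C₂, D` with
indices `c, c₁, c₂, d`:
`∀ C (H(C) → ∃ y C y) ∧ ∀ C₁ ∀ C₂ (H(C₁) ∧ H(C₂) ∧ C₁ ≠ C₂ → ¬ ∃ y (C₁ y ∧ C₂ y))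
  → ∃ D ∀ C (H(C) → ∃!! y (C y ∧ D y))`. -/
def choiceStarAxiom (H : Formula) (c c₁ c₂ d : ℕ) : Formula :=
  .imp
    (.and
      (.allPred 0 c (.imp H (.ex 0 (.app₁ c 0))))
      (.allPred 0 c₁ (.allPred 0 c₂ (.imp
        (.and (.and (H.substPred 0 c c₁) (H.substPred 0 c c₂)) (.neg (.predEq 0 c₁ c₂)))
        (.neg (.ex 0 (.and (.app₁ c₁ 0) (.app₁ c₂ 0))))))))
    (.exPred 0 d (.allPred 0 c (.imp H
      (.exUnique 0 1 fun y => .and (.app₁ c y) (.app₁ d y)))))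

/-- Asser's Russell-type principle of choice for unary predicates: all axioms for formulas `H`
in which `C` occurs only free. The auxiliary variables `C₁, C₂, D` do not occur in `H`; other
variables may occur free in `H`. -/
def choiceStar1 : Set Formula :=
  {F | ∃ (H : Formula) (c c₁ c₂ d : ℕ),
    H.WellFormed ∧ ¬ H.BindsPred 0 c ∧ [c, c₁, c₂, d].Nodup ∧
    ¬ H.OccursPred 0 c₁ ∧ ¬ H.OccursPred 0 c₂ ∧ ¬ H.OccursPred 0 d ∧
    F = choiceStarAxiom H c c₁ c₂ d}

end HPL

/-! The non-refutation is easy: in a structure with all predicates on a non-empty set, both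
principles follow from choice in the metatheory.

For the failure of entailment, a Fraenkel-Mostowski style structure is used. The individuals form
countably many disjoint pairs, `G` is the group of all permutations mapping pairs to pairs, and the
predicates are those with finite support under `G`. Truth is invariant under `G`, so a definable
predicate is supported by the values and supports of its finitely many parameters; this gives
comprehension (`isHenkin_symmetric`).

No finitely supported set selects one element from every pair, since swapping the two elements of a
pair outside the support preserves the set. "Being a pair" is definable from an invariant
equivalence relation, which gives a false instance of `choiceStar1`
(`model_not_valid_choiceStarAxiom`).

`AC11` survives because it chooses relative to an individual `x`, and `x` distinguishes itself from
its partner. If `R x y` holds with `y` far from the support and from `x`, a permutation moves `y`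
into a fixed finite set of pairs. So each non-empty section of `R` meets a finite set that is
ordered equivariantly in `x`, and its least element can be selected (`model_valid_AC11`). -/

namespace HPL

/-! ### Variables occurring in a formula -/

namespace Formula

/-- The individual variable `x` occurs (free or bound) in the formula. -/
def OccursInd (x : ℕ) : Formula → Prop
  | app _ _ v => ∃ k, v k = x
  | indEq i j => i = x ∨ j = x
  | predEq _ _ _ => False
  | neg F => F.OccursInd x
  | and F G => F.OccursInd x ∨ G.OccursInd x
  | or F G => F.OccursInd x ∨ G.OccursInd x
  | imp F G => F.OccursInd x ∨ G.OccursInd x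
  | iff F G => F.OccursInd x ∨ G.OccursInd x
  | all i F => i = x ∨ F.OccursInd x
  | ex i F => i = x ∨ F.OccursInd x
  | allPred _ _ F => F.OccursInd x
  | exPred _ _ F => F.OccursInd x

/-- Together with `finite_occursPred`, this keeps the supports of definable predicates finite. -/
theorem finite_occursInd (F : Formula) : {x | F.OccursInd x}.Finite := by
  have single (i : ℕ) : {x | i = x}.Finite :=
    (Set.finite_singleton i).subset fun _ h => h.symm
  induction F with
  | app n i v => exact Set.finite_range v
  | indEq i j =>
    refine (Set.toFinite {i, j}).subset ?_
    rintro x (rfl | rfl) <;> simp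
  | predEq n i j => simp [OccursInd]
  | neg F ih => exact ih
  | and F G ihF ihG => exact ihF.union ihG
  | or F G ihF ihG => exact ihF.union ihG
  | imp F G ihF ihG => exact ihF.union ihG
  | iff F G ihF ihG => exact ihF.union ihG
  | all i F ih => exact (single i).union ih
  | ex i F ih => exact (single i).union ih
  | allPred n i F ih => exact ih
  | exPred n i F ih => exact ih

theorem finite_occursPred (F : Formula) : {p : ℕ × ℕ | F.OccursPred p.1 p.2}.Finite := by
  have single (n i : ℕ) : {p : ℕ × ℕ | n = p.1 ∧ i = p.2}.Finite := by
    refine (Set.finite_singleton (n, i)).subset ?_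
    rintro ⟨a, b⟩ ⟨rfl, rfl⟩
    rfl
  induction F with
  | app n i v => exact single n i
  | indEq i j => simp [OccursPred]
  | predEq n i j =>
    refine ((single n i).union (single n j)).subset ?_
    rintro p ⟨h, h' | h'⟩
    · exact Or.inl ⟨h, h'⟩
    · exact Or.inr ⟨h, h'⟩
  | neg F ih => exact ih
  | and F G ihF ihG => exact ihF.union ihG
  | or F G ihF ihG => exact ihF.union ihG
  | imp F G ihF ihG => exact ihF.union ihG
  | iff F G ihF ihG => exact ihF.union ihG
  | all i F ih => exact ih
  | ex i F ih => exact ih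
  | allPred n i F ih => exact (single n i).union ih
  | exPred n i F ih => exact (single n i).union ih

end Formula

namespace Assignment

variable {M : PredStructure.{u}}

@[simp]
theorem setPred_pred_self (f : Assignment M) (n i : ℕ) (α : M.Pred n) :
    (f.setPred n i α).pred n i = α := by
  simp [setPred]

theorem setPred_pred_of_ne (f : Assignment M) {n i m j : ℕ} (α : M.Pred n)
    (h : ¬ (n = m ∧ i = j)) : (f.setPred n i α).pred m j = f.pred m j := by
  by_cases hn : n = m
  · subst hn
    have : j ≠ i := fun e => h ⟨rfl, e.symm⟩
    simp [setPred, this]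
  · simp [setPred, Function.update_of_ne (Ne.symm hn)]

@[simp]
theorem setInd_pred (f : Assignment M) (i : ℕ) (ξ : M.Ind) :
    (f.setInd i ξ).pred = f.pred := rfl

theorem setInd_ind (f : Assignment M) (i j : ℕ) (ξ : M.Ind) :
    (f.setInd i ξ).ind j = if j = i then ξ else f.ind j := by
  simp [setInd, Function.update_apply]

end Assignment

/-! ### Automorphism invariance, coincidence and substitution -/

namespace PredStructure

variable {M : PredStructure.{u}}

/-- Truth is transferred along a permutation of the individuals under which the predicate
domains are invariant; only the values of the variables that occur in the formula matter. -/
theorem sat_congr_of_perm (π : Equiv.Perm M.Ind)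
    (hπ : ∀ (n : ℕ) (P : (Fin (n + 1) → M.Ind) → Prop), P ∈ M.Pred n →
      (fun v => P (π ∘ v)) ∈ M.Pred n ∧ (fun v => P (π.symm ∘ v)) ∈ M.Pred n)
    (F : Formula) (f g : Assignment M) (hi : ∀ i, F.OccursInd i → g.ind i = π (f.ind i))
    (hp : ∀ n i, F.OccursPred n i → ∀ v, (g.pred n i).1 (π ∘ v) ↔ (f.pred n i).1 v) :
    M.Sat g F ↔ M.Sat f F := by
  have setInd_aux (F : Formula) (j : ℕ) (f g : Assignment M)
      (hi : ∀ i, (j = i ∨ F.OccursInd i) → g.ind i = π (f.ind i)) (ξ : M.Ind) :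
      ∀ i, F.OccursInd i → (g.setInd j (π ξ)).ind i = π ((f.setInd j ξ).ind i) := by
    intro i h
    simp only [Assignment.setInd_ind]
    split_ifs
    · rfl
    · exact hi i (Or.inr h)
  have setPred_aux (F : Formula) (m j : ℕ) (f g : Assignment M)
      (hp : ∀ n i, ((m = n ∧ j = i) ∨ F.OccursPred n i) →
        ∀ v, (g.pred n i).1 (π ∘ v) ↔ (f.pred n i).1 v)
      (α β : M.Pred m) (hαβ : ∀ v, β.1 (π ∘ v) ↔ α.1 v) :
      ∀ n i, F.OccursPred n i →
        ∀ v, ((g.setPred m j β).pred n i).1 (π ∘ v) ↔ ((f.setPred m j α).pred n i).1 v := by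
    intro n i h
    by_cases e : m = n ∧ j = i
    · obtain ⟨rfl, rfl⟩ := e
      simpa using hαβ
    · rw [Assignment.setPred_pred_of_ne _ _ e, Assignment.setPred_pred_of_ne _ _ e]
      exact hp n i (Or.inr h)
  have comp_symm {n : ℕ} (v : Fin (n + 1) → M.Ind) : π ∘ π.symm ∘ v = v := by
    funext k; simp
  have symm_comp {n : ℕ} (v : Fin (n + 1) → M.Ind) : π.symm ∘ π ∘ v = v := by
    funext k; simp
  induction F generalizing f g with
  | app n i v =>
    have : (fun k => g.ind (v k)) = π ∘ fun k => f.ind (v k) :=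
      funext fun k => hi (v k) ⟨k, rfl⟩
    simp only [Sat, this]
    exact hp n i ⟨rfl, rfl⟩ _
  | indEq i j =>
    simp only [Sat, hi i (Or.inl rfl), hi j (Or.inr rfl), EmbeddingLike.apply_eq_iff_eq]
  | predEq n i j =>
    have hpi := hp n i ⟨rfl, Or.inl rfl⟩
    have hpj := hp n j ⟨rfl, Or.inr rfl⟩
    simp only [Sat]
    constructor
    · intro h
      refine Subtype.ext (funext fun v => propext ?_)
      rw [← hpi, ← hpj, h]
    · intro h
      refine Subtype.ext (funext fun v => propext ?_)
      rw [← comp_symm v, hpi, hpj, h]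
  | neg F ih => exact not_congr (ih f g hi hp)
  | and F G ihF ihG =>
    exact and_congr (ihF f g (fun i h => hi i (.inl h)) fun n i h => hp n i (.inl h))
      (ihG f g (fun i h => hi i (.inr h)) fun n i h => hp n i (.inr h))
  | or F G ihF ihG =>
    exact or_congr (ihF f g (fun i h => hi i (.inl h)) fun n i h => hp n i (.inl h))
      (ihG f g (fun i h => hi i (.inr h)) fun n i h => hp n i (.inr h))
  | imp F G ihF ihG =>
    exact imp_congr (ihF f g (fun i h => hi i (.inl h)) fun n i h => hp n i (.inl h))
      (ihG f g (fun i h => hi i (.inr h)) fun n i h => hp n i (.inr h))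
  | iff F G ihF ihG =>
    exact iff_congr (ihF f g (fun i h => hi i (.inl h)) fun n i h => hp n i (.inl h))
      (ihG f g (fun i h => hi i (.inr h)) fun n i h => hp n i (.inr h))
  | all j F ih =>
    refine (π.forall_congr fun ξ => ?_).symm
    exact (ih _ _ (setInd_aux F j f g hi ξ) hp).symm
  | ex j F ih =>
    refine (π.exists_congr fun ξ => ?_).symm
    exact (ih _ _ (setInd_aux F j f g hi ξ) hp).symm
  | allPred m j F ih =>
    constructor
    · intro h α
      -- A predicate quantifier needs the transported predicate to lie in the domain again; `hπ`
      -- provides this in both directions.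
      exact (ih (f.setPred m j _) (g.setPred m j _) hi (setPred_aux F m j f g hp α ⟨_, (hπ m _ α.2).2⟩ fun v => by
        simp only [symm_comp])).1 (h _)
    · intro h β
      exact (ih (f.setPred m j _) (g.setPred m j _) hi (setPred_aux F m j f g hp ⟨_, (hπ m _ β.2).1⟩ β fun v => Iff.rfl)).2 (h _)
  | exPred m j F ih =>
    constructor
    · rintro ⟨β, h⟩
      exact ⟨_, (ih (f.setPred m j _) (g.setPred m j _) hi
        (setPred_aux F m j f g hp ⟨_, (hπ m _ β.2).1⟩ β fun v => Iff.rfl)).1 h⟩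
    · rintro ⟨α, h⟩
      exact ⟨_, (ih (f.setPred m j _) (g.setPred m j _) hi (setPred_aux F m j f g hp α ⟨_, (hπ m _ α.2).2⟩ fun v => by
        simp only [symm_comp])).2 h⟩

/-- The truth of a formula depends only on the values of the variables that occur in it. -/
theorem sat_congr (F : Formula) (f g : Assignment M) (hi : g.ind = f.ind)
    (hp : ∀ n i, F.OccursPred n i → g.pred n i = f.pred n i) : M.Sat g F ↔ M.Sat f F :=
  sat_congr_of_perm (Equiv.refl _) (fun _ _ hP => ⟨hP, hP⟩) F f g (fun i _ => congrFun hi i)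
    fun n i h v => by rw [hp n i h]; rfl

theorem sat_substPred (F : Formula) {m c d : ℕ} (hc : ¬ F.BindsPred m c)
    (hd : ¬ F.OccursPred m d) (f g : Assignment M) (hi : g.ind = f.ind)
    (hp : ∀ n i, g.pred n i = f.pred n (if n = m ∧ i = c then d else i)) :
    M.Sat f (F.substPred m c d) ↔ M.Sat g F := by
  -- A quantified variable differs from both `c` and `d`, so updating it commutes with the renaming
  -- and nothing is captured.
  have setPred_aux {n j : ℕ} (hc : ¬ (n = m ∧ j = c)) (hd : ¬ (n = m ∧ j = d))
      (f g : Assignment M)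
      (hp : ∀ n i, g.pred n i = f.pred n (if n = m ∧ i = c then d else i)) (α : M.Pred n) :
      ∀ n' i, (g.setPred n j α).pred n' i =
        (f.setPred n j α).pred n' (if n' = m ∧ i = c then d else i) := by
    intro n' i
    by_cases e : n = n' ∧ j = i
    · obtain ⟨rfl, rfl⟩ := e
      simp [hc]
    · rw [Assignment.setPred_pred_of_ne _ _ e, hp, Assignment.setPred_pred_of_ne]
      split_ifs with h
      · rintro ⟨rfl, rfl⟩
        exact hd ⟨h.1, rfl⟩
      · exact e
  induction F generalizing f g with
  | app n i v => simp only [Formula.substPred, Sat, hp n i, hi]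
  | indEq i j => simp only [Formula.substPred, Sat, hi]
  | predEq n i j => simp only [Formula.substPred, Sat, hp n i, hp n j]
  | neg F ih => exact not_congr (ih hc hd f g hi hp)
  | and F G ihF ihG =>
    exact and_congr (ihF (fun h => hc (.inl h)) (fun h => hd (.inl h)) f g hi hp)
      (ihG (fun h => hc (.inr h)) (fun h => hd (.inr h)) f g hi hp)
  | or F G ihF ihG =>
    exact or_congr (ihF (fun h => hc (.inl h)) (fun h => hd (.inl h)) f g hi hp)
      (ihG (fun h => hc (.inr h)) (fun h => hd (.inr h)) f g hi hp)
  | imp F G ihF ihG =>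
    exact imp_congr (ihF (fun h => hc (.inl h)) (fun h => hd (.inl h)) f g hi hp)
      (ihG (fun h => hc (.inr h)) (fun h => hd (.inr h)) f g hi hp)
  | iff F G ihF ihG =>
    exact iff_congr (ihF (fun h => hc (.inl h)) (fun h => hd (.inl h)) f g hi hp)
      (ihG (fun h => hc (.inr h)) (fun h => hd (.inr h)) f g hi hp)
  | all j F ih =>
    exact forall_congr' fun ξ => ih hc hd _ _ (by simp [Assignment.setInd, hi]) hp
  | ex j F ih =>
    exact exists_congr fun ξ => ih hc hd _ _ (by simp [Assignment.setInd, hi]) hp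
  | allPred n j F ih =>
    have hc' : ¬ (n = m ∧ j = c) := fun h => hc (.inl h)
    simp only [Formula.substPred, if_neg hc']
    exact forall_congr' fun α => ih (fun h => hc (.inr h)) (fun h => hd (.inr h)) _ _ hi
      (setPred_aux hc' (fun h => hd (.inl h)) f g hp α)
  | exPred n j F ih =>
    have hc' : ¬ (n = m ∧ j = c) := fun h => hc (.inl h)
    simp only [Formula.substPred, if_neg hc']
    exact exists_congr fun α => ih (fun h => hc (.inr h)) (fun h => hd (.inr h)) _ _ hi
      (setPred_aux hc' (fun h => hd (.inl h)) f g hp α)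

theorem sat_foldr_all (l : List ℕ) (F : Formula) (f : Assignment M)
    (h : ∀ g : Assignment M, g.pred = f.pred → (∀ i ∉ l, g.ind i = f.ind i) → M.Sat g F) :
    M.Sat f (l.foldr .all F) := by
  induction l generalizing f with
  | nil => exact h f rfl fun _ _ => rfl
  | cons a l ih =>
    intro ξ
    refine ih _ fun g hg hi => h g hg fun i hil => ?_
    rw [List.mem_cons, not_or] at hil
    rw [hi i hil.2, Assignment.setInd_ind, if_neg hil.1]

/-! ### Comprehension from definable predicates, and semantics of the axioms -/

/-- The predicate defined by the formula `F` and the variables `v` under the assignment `f`. -/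
def definedPred (f : Assignment M) {n : ℕ} (v : Fin (n + 1) → ℕ) (F : Formula) :
    (Fin (n + 1) → M.Ind) → Prop :=
  fun w => ∃ g : Assignment M, g.pred = f.pred ∧ (∀ i ∉ Set.range v, g.ind i = f.ind i) ∧
    g.ind ∘ v = w ∧ M.Sat g F

theorem isHenkin_of_definedPred_mem
    (h : ∀ (f : Assignment M) (n : ℕ) (v : Fin (n + 1) → ℕ) (F : Formula),
      definedPred f v F ∈ M.Pred n) : IsHenkin M := by
  rintro _ ⟨n, a, v, F, -, -, -, ha, rfl⟩ f
  refine ⟨⟨_, h f n v F⟩, ?_⟩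
  refine sat_foldr_all _ _ _ fun g hg hi => ?_
  -- The new value of the variable being defined does not affect `F`, in which this variable does
  -- not occur.
  have hgf : ∀ m i, F.OccursPred m i → g.pred m i = f.pred m i := by
    intro m i hmi
    rw [hg, Assignment.setPred_pred_of_ne]
    rintro ⟨rfl, rfl⟩
    exact ha hmi
  have hi' : ∀ i ∉ Set.range v, g.ind i = f.ind i := fun i hiv =>
    hi i (by rwa [List.mem_ofFn])
  simp only [Sat, hg, Assignment.setPred_pred_self]
  constructor
  · rintro ⟨g', hp, hi₁, hi₂, hs⟩
    refine (sat_congr F g' g (funext fun i => ?_) fun m i hmi => ?_).2 hs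
    · by_cases hiv : i ∈ Set.range v
      · obtain ⟨k, rfl⟩ := hiv
        exact (congrFun hi₂ k).symm
      · rw [hi' i hiv, hi₁ i hiv]
    · rw [hgf m i hmi, hp]
  · intro hs
    exact ⟨⟨g.ind, f.pred⟩, rfl, hi', rfl,
      (sat_congr F g ⟨g.ind, f.pred⟩ rfl fun m i hmi => (hgf m i hmi).symm).2 hs⟩

theorem sat_exUnique {f : Assignment M} {y z : ℕ} {F : ℕ → Formula} {P : M.Ind → Prop}
    (hyz : y ≠ z) (hy : ∀ g : Assignment M, g.pred = f.pred →
      (∀ i, i ≠ y → i ≠ z → g.ind i = f.ind i) → (M.Sat g (F y) ↔ P (g.ind y)))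
    (hz : ∀ g : Assignment M, g.pred = f.pred →
      (∀ i, i ≠ y → i ≠ z → g.ind i = f.ind i) → (M.Sat g (F z) ↔ P (g.ind z))) :
    M.Sat f (.exUnique y z F) ↔ ∃! ξ, P ξ := by
  have h1 (ξ : M.Ind) : M.Sat (f.setInd y ξ) (F y) ↔ P ξ := by
    rw [hy (f.setInd y ξ) rfl fun i h _ => by rw [Assignment.setInd_ind, if_neg h]]
    simp [Assignment.setInd_ind]
  have h2 (ξ η : M.Ind) (i : ℕ) (h : i ≠ y) (h' : i ≠ z) :
      ((f.setInd y ξ).setInd z η).ind i = f.ind i := by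
    simp [Assignment.setInd_ind, h, h']
  have h3 (ξ η : M.Ind) : M.Sat ((f.setInd y ξ).setInd z η) (F y) ↔ P ξ := by
    rw [hy ((f.setInd y ξ).setInd z η) rfl (h2 ξ η)]
    simp [Assignment.setInd_ind, hyz]
  have h4 (ξ η : M.Ind) : M.Sat ((f.setInd y ξ).setInd z η) (F z) ↔ P η := by
    rw [hz ((f.setInd y ξ).setInd z η) rfl (h2 ξ η)]
    simp [Assignment.setInd_ind]
  simp only [Formula.exUnique, Sat, h1, h3, h4, Assignment.setInd_ind, hyz, if_true, if_false]
  constructor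
  · rintro ⟨⟨ξ, hξ⟩, h⟩
    exact ⟨ξ, hξ, fun η hη => h η ξ ⟨hη, hξ⟩⟩
  · rintro ⟨ξ, hξ, h⟩
    exact ⟨⟨ξ, hξ⟩, fun η ζ hh => (h η hh.1).trans (h ζ hh.2).symm⟩

theorem sat_app₁ (f : Assignment M) (c y : ℕ) :
    M.Sat f (.app₁ c y) ↔ (f.pred 0 c).1 ![f.ind y] := by
  have : (fun k => f.ind (![y] k)) = ![f.ind y] := by
    funext k; fin_cases k; rfl
  simp only [Formula.app₁, Sat, this]

theorem sat_app₂ (f : Assignment M) (r y z : ℕ) :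
    M.Sat f (.app₂ r y z) ↔ (f.pred 1 r).1 ![f.ind y, f.ind z] := by
  have : (fun k => f.ind (![y, z] k)) = ![f.ind y, f.ind z] := by
    funext k; fin_cases k <;> rfl
  simp only [Formula.app₂, Sat, this]

/-- The Zermelo-Asser axiom holds if all binary predicates can be uniformized. -/
theorem valid_AC11
    (h : ∀ R : M.Pred 1, ∃ S : M.Pred 1, ∀ x y, R.1 ![x, y] →
      ∃! z, R.1 ![x, z] ∧ S.1 ![x, z]) : M.Valid AC11 := by
  intro f A R
  obtain ⟨S, hS⟩ := h R
  refine ⟨S, fun hA x hx => ?_⟩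
  have hA := hA x
  simp only [Sat, sat_app₁, sat_app₂] at hA hx
  obtain ⟨y, hy⟩ := hA.1 hx
  refine (sat_exUnique (P := fun z => R.1 ![x, z] ∧ S.1 ![x, z]) (by decide) ?_ ?_).2 (hS x y ?_)
  · intro g hp hi
    simp only [Sat, sat_app₂, hp, hi 0 (by decide) (by decide)]
    simp [Assignment.setPred_pred_of_ne, Assignment.setInd_ind]
  · intro g hp hi
    simp only [Sat, sat_app₂, hp, hi 0 (by decide) (by decide)]
    simp [Assignment.setPred_pred_of_ne, Assignment.setInd_ind]
  · simpa [Assignment.setPred_pred_of_ne, Assignment.setInd_ind] using hy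

/-! ### Standard structures satisfy both principles -/

/-- The structure with all predicates on `X`. -/
abbrev standard (X : Type u) [Nonempty X] : PredStructure.{u} where
  Ind := X
  ind_nonempty := inferInstance
  Pred _ := Set.univ
  pred_nonempty _ := Set.univ_nonempty

theorem isHenkin_standard (X : Type u) [Nonempty X] : IsHenkin (standard X) :=
  isHenkin_of_definedPred_mem fun _ _ _ _ => Set.mem_univ _

theorem standard_valid_AC11 (X : Type u) [Nonempty X] : (standard X).Valid AC11 := by
  refine valid_AC11 fun R => ?_
  refine ⟨⟨fun v => ∃ h : ∃ y, R.1 ![v 0, y], v 1 = h.choose, Set.mem_univ _⟩, fun x y hxy => ?_⟩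
  have h : ∃ y, R.1 ![x, y] := ⟨y, hxy⟩
  exact ⟨h.choose, ⟨h.choose_spec, h, rfl⟩, fun z hz => hz.2.choose_spec⟩

theorem standard_models_choiceStar1 (X : Type u) [Nonempty X] :
    (standard X).Models choiceStar1 := by
  rintro _ ⟨H, c, c₁, c₂, d, -, hb, hn, h₁, h₂, hd, rfl⟩ f ⟨hne, hdisj⟩
  simp only [List.nodup_cons, List.mem_cons, List.not_mem_nil, or_false, not_or] at hn
  obtain ⟨⟨hcc₁, hcc₂, hcd⟩, ⟨hc₁₂, -⟩, -⟩ := hn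
  have hne' (C : (standard X).Pred 0) (hC : (standard X).Sat (f.setPred 0 c C) H) :
      ∃ y, C.1 ![y] := by
    obtain ⟨y, hy⟩ := hne C hC
    rw [sat_app₁] at hy
    exact ⟨y, by simpa [Assignment.setInd_ind] using hy⟩
  have hdisj' (C₁ C₂ : (standard X).Pred 0) (hC₁ : (standard X).Sat (f.setPred 0 c C₁) H)
      (hC₂ : (standard X).Sat (f.setPred 0 c C₂) H) (y : X) (hy₁ : C₁.1 ![y])
      (hy₂ : C₂.1 ![y]) : C₁ = C₂ := by
    by_contra hne
    set g := (f.setPred 0 c₁ C₁).setPred 0 c₂ C₂ with hg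
    have hg₁ : g.pred 0 c₁ = C₁ := by
      rw [hg, Assignment.setPred_pred_of_ne _ _ fun h => hc₁₂ h.2.symm]
      simp
    have hg₂ : g.pred 0 c₂ = C₂ := by simp [hg]
    have subst_iff (e : ℕ) (he : ¬ H.OccursPred 0 e) (hce : c ≠ e) (C : (standard X).Pred 0)
        (hgC : g.pred 0 e = C) (hC : (standard X).Sat (f.setPred 0 c C) H) :
        (standard X).Sat g (H.substPred 0 c e) := by
      refine (sat_substPred H hb he g (g.setPred 0 c C) rfl fun n i => ?_).2 ?_
      · split_ifs with h
        · obtain ⟨rfl, rfl⟩ := h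
          simp [hgC]
        · rw [Assignment.setPred_pred_of_ne]
          exact fun h' => h ⟨h'.1.symm, h'.2.symm⟩
      · refine (sat_congr H (f.setPred 0 c C) (g.setPred 0 c C) rfl fun n i hni => ?_).2 hC
        by_cases h : 0 = n ∧ c = i
        · obtain ⟨rfl, rfl⟩ := h
          simp
        · rw [Assignment.setPred_pred_of_ne _ _ h, Assignment.setPred_pred_of_ne _ _ h, hg,
            Assignment.setPred_pred_of_ne, Assignment.setPred_pred_of_ne]
          · rintro ⟨rfl, rfl⟩
            exact h₁ hni
          · rintro ⟨rfl, rfl⟩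
            exact h₂ hni
    refine hdisj C₁ C₂ ⟨⟨subst_iff c₁ h₁ hcc₁ C₁ hg₁ hC₁, subst_iff c₂ h₂ hcc₂ C₂ hg₂ hC₂⟩, ?_⟩
      ⟨y, ?_⟩
    · change ¬ (g.pred 0 c₁ = g.pred 0 c₂)
      rwa [hg₁, hg₂]
    · change (standard X).Sat (g.setInd 0 y) _ ∧ (standard X).Sat (g.setInd 0 y) _
      rw [sat_app₁, sat_app₁, Assignment.setInd_pred, hg₁, hg₂, Assignment.setInd_ind]
      exact ⟨hy₁, hy₂⟩
  -- `D` collects one chosen element from each `C` satisfying `H`.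
  refine ⟨⟨fun v => ∃ (C : (standard X).Pred 0) (h : (standard X).Sat (f.setPred 0 c C) H),
    v 0 = (hne' C h).choose, Set.mem_univ _⟩, fun C hC => ?_⟩
  have hC' : (standard X).Sat (f.setPred 0 c C) H := by
    refine (sat_congr H _ _ ?_ fun n i hni => ?_).1 hC
    · rfl
    · by_cases h : 0 = n ∧ c = i
      · obtain ⟨rfl, rfl⟩ := h
        simp
      · rw [Assignment.setPred_pred_of_ne _ _ h, Assignment.setPred_pred_of_ne _ _ h,
          Assignment.setPred_pred_of_ne]
        rintro ⟨rfl, rfl⟩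
        exact hd hni
  refine (sat_exUnique (P := fun y => C.1 ![y] ∧
    ∃ (C : (standard X).Pred 0) (h : (standard X).Sat (f.setPred 0 c C) H),
      y = (hne' C h).choose) (by decide) ?_ ?_).2 ?_
  · intro g hp _
    simp only [Sat, sat_app₁, hp, Assignment.setPred_pred_self]
    rw [Assignment.setPred_pred_of_ne _ _ fun h => hcd h.2]
    simp
  · intro g hp _
    simp only [Sat, sat_app₁, hp, Assignment.setPred_pred_self]
    rw [Assignment.setPred_pred_of_ne _ _ fun h => hcd h.2]
    simp
  · refine ⟨(hne' C hC').choose, ⟨(hne' C hC').choose_spec, C, hC', rfl⟩, ?_⟩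
    -- An element chosen for `C'` that also lies in `C` forces `C' = C` by disjointness.
    rintro y ⟨hy, C', h', rfl⟩
    have := hdisj' C C' hC' h' _ hy (hne' C' h').choose_spec
    subst this
    rfl

/-! ### Structures of finitely supported predicates -/

/-- The predicate `P` is invariant under all elements of `G` that fix the set `s` pointwise. -/
def SupportedBy {X : Type u} (G : Subgroup (Equiv.Perm X)) (s : Set X) {n : ℕ}
    (P : (Fin (n + 1) → X) → Prop) : Prop :=
  ∀ π ∈ G, (∀ x ∈ s, π x = x) → ∀ v, P (π ∘ v) ↔ P v

theorem SupportedBy.of_imp {X : Type u} {G : Subgroup (Equiv.Perm X)} {s : Set X} {n : ℕ}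
    {P : (Fin (n + 1) → X) → Prop}
    (h : ∀ π ∈ G, (∀ x ∈ s, π x = x) → ∀ v, P v → P (π ∘ v)) : SupportedBy G s P := by
  refine fun π hπ hs v => ⟨fun hv => ?_, h π hπ hs v⟩
  have := h π⁻¹ (G.inv_mem hπ) (fun x hx => by
    rw [Equiv.Perm.inv_eq_iff_eq, hs x hx]) _ hv
  have e : ⇑π⁻¹ ∘ ⇑π ∘ v = v := by funext k; simp
  rwa [e] at this

/-- The structure of all predicates with finite support with respect to the group `G`. -/
abbrev symmetric (X : Type u) [Nonempty X] (G : Subgroup (Equiv.Perm X)) : PredStructure.{u} where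
  Ind := X
  ind_nonempty := inferInstance
  Pred _ := {P | ∃ s : Set X, s.Finite ∧ SupportedBy G s P}
  pred_nonempty _ := ⟨fun _ => True, ∅, Set.finite_empty, fun _ _ _ _ => Iff.rfl⟩

section Symmetric

variable {X : Type u} [Nonempty X] {G : Subgroup (Equiv.Perm X)}

theorem symmetric_comp_mem {π : Equiv.Perm X} (hπ : π ∈ G) {n : ℕ}
    {P : (Fin (n + 1) → X) → Prop} (hP : P ∈ (symmetric X G).Pred n) :
    (fun v => P (π ∘ v)) ∈ (symmetric X G).Pred n := by
  obtain ⟨s, hs, hP⟩ := hP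
  -- If `ρ` fixes the preimage of `s` pointwise, then the conjugate of `ρ` by `π` fixes `s`
  -- pointwise.
  refine ⟨π ⁻¹' s, hs.preimage π.injective.injOn, fun ρ hρ hfix v => ?_⟩
  have := hP (π * ρ * π⁻¹) (G.mul_mem (G.mul_mem hπ hρ) (G.inv_mem hπ)) (fun x hx => by
    have : ρ (π.symm x) = π.symm x := hfix _ (by simpa using hx)
    simp [this]) (π ∘ v)
  change P (π ∘ ρ ∘ v) ↔ P (π ∘ v)
  rw [← this]
  have e : ⇑(π * ρ * π⁻¹) ∘ ⇑π ∘ v = π ∘ ρ ∘ v := by funext k; simp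
  rw [e]

/-- A defined predicate is supported by the values of the individual parameters together with the
supports of the predicate parameters: a permutation in `G` fixing these moves only the arguments. -/
theorem isHenkin_symmetric : IsHenkin (symmetric X G) := by
  classical
  refine isHenkin_of_definedPred_mem fun f n v F => ?_
  choose supp hsupp_fin hsupp using fun (n i : ℕ) => (f.pred n i).2
  refine ⟨f.ind '' {i | F.OccursInd i} ∪
      ⋃ p ∈ {p : ℕ × ℕ | F.OccursPred p.1 p.2}, supp p.1 p.2,
    (F.finite_occursInd.image _).union
      (F.finite_occursPred.biUnion fun p _ => hsupp_fin p.1 p.2), .of_imp ?_⟩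
  rintro π hπ hfix w ⟨g, hp, hi, rfl, hs⟩
  refine ⟨⟨fun i => if i ∈ Set.range v then π (g.ind i) else f.ind i, f.pred⟩, rfl,
    fun i hiv => if_neg hiv, ?_, ?_⟩
  · funext k
    exact if_pos ⟨k, rfl⟩
  · refine (sat_congr_of_perm (M := symmetric X G) π (fun m P hP =>
      ⟨symmetric_comp_mem hπ hP, symmetric_comp_mem (G.inv_mem hπ) hP⟩) F g _ ?_ ?_).2 hs
    · intro i hiF
      by_cases hiv : i ∈ Set.range v
      · exact if_pos hiv
      · refine (if_neg hiv).trans ?_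
        rw [hi i hiv]
        exact (hfix _ (Or.inl ⟨i, hiF, rfl⟩)).symm
    · intro m i hmi
      rw [hp]
      exact hsupp m i π hπ fun x hx => hfix x (Or.inr (Set.mem_biUnion (x := (m, i)) hmi hx))

end Symmetric

end PredStructure

open PredStructure

/-! ### The structure on pairs satisfies `AC11` -/

/-- Countably many disjoint pairs. -/
abbrev Pairs : Type u := ℕ × ULift.{u} Bool

namespace Pairs

/-- The permutations that map pairs to pairs. -/
def pairGroup : Subgroup (Equiv.Perm Pairs.{u}) where
  carrier := {π | ∀ x y, (π x).1 = (π y).1 ↔ x.1 = y.1}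
  one_mem' _ _ := Iff.rfl
  mul_mem' hπ hρ x y := (hπ _ _).trans (hρ x y)
  inv_mem' {π} hπ x y := by
    have := hπ (π⁻¹ x) (π⁻¹ y)
    simpa using this.symm

theorem prodCongr_mem_pairGroup (σ : Equiv.Perm ℕ) :
    (Equiv.prodCongr σ (Equiv.refl _) : Equiv.Perm Pairs.{u}) ∈ pairGroup := by
  intro x y
  simp

/-- The transposition of a single pair. -/
def swapPair (k : ℕ) : Equiv.Perm Pairs.{u} :=
  Equiv.swap (k, ⟨false⟩) (k, ⟨true⟩)

theorem swapPair_fst (k : ℕ) (x : Pairs.{u}) : (swapPair k x).1 = x.1 := by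
  unfold swapPair
  rw [Equiv.swap_apply_def]
  split_ifs with h h'
  · rw [h]
  · rw [h']
  · rfl

theorem swapPair_of_ne {k : ℕ} {x : Pairs.{u}} (h : x.1 ≠ k) : swapPair k x = x :=
  Equiv.swap_apply_of_ne_of_ne (fun e => h (by rw [e])) fun e => h (by rw [e])

theorem swapPair_ne {k : ℕ} {x : Pairs.{u}} (h : x.1 = k) : swapPair k x ≠ x := by
  obtain ⟨n, ⟨b⟩⟩ := x
  obtain rfl : n = k := h
  cases b <;> simp [swapPair]

theorem swapPair_mem_pairGroup (k : ℕ) : swapPair.{u} k ∈ pairGroup := by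
  intro x y
  rw [swapPair_fst, swapPair_fst]

theorem exists_bound {s : Set Pairs.{u}} (hs : s.Finite) : ∃ N, ∀ x ∈ s, x.1 < N := by
  obtain ⟨N, hN⟩ := (hs.image Prod.fst).bddAbove
  exact ⟨N + 1, fun x hx => Nat.lt_succ_of_le (hN ⟨x, hx, rfl⟩)⟩

/-- An enumeration of the pairs below `N` and the pair of `x`. -/
def rank (N : ℕ) (x y : Pairs.{u}) : ℕ :=
  open Classical in
  if y.1 < N then 2 * y.1 + (if y.2.down then 1 else 0) else 2 * N + (if y = x then 0 else 1)

theorem rank_injOn (N : ℕ) (x : Pairs.{u}) :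
    Set.InjOn (rank N x) {y | y.1 < N ∨ y.1 = x.1} := by
  classical
  rintro ⟨a, ⟨b⟩⟩ hy ⟨a', ⟨b'⟩⟩ hz h
  obtain ⟨m, ⟨e⟩⟩ := x
  simp only [Set.mem_ofPred_eq] at hy hz
  simp only [rank, Prod.mk.injEq, ULift.up.injEq] at h ⊢
  cases b <;> cases b' <;> cases e <;> simp at h ⊢ <;> split_ifs at h <;> omega

/-- Beyond the pairs below `N`, the rank only asks whether `y = x`, which every permutation
respects. -/
theorem rank_perm {N : ℕ} {π : Equiv.Perm Pairs.{u}} (hπ : ∀ x, x.1 < N → π x = x)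
    (x y : Pairs.{u}) : rank N (π x) (π y) = rank N x y := by
  by_cases hy : y.1 < N
  · simp [rank, hπ y hy, hy]
  · have : ¬ (π y).1 < N := fun h => hy (by rwa [π.injective (hπ _ h)] at h)
    simp [rank, hy, this]

/-- The structure of all predicates on `Pairs` with finite support. -/
abbrev model : PredStructure.{u} := symmetric Pairs.{u} pairGroup

theorem model_valid_AC11 : model.{u}.Valid AC11 := by
  refine valid_AC11 fun R => ?_
  obtain ⟨R, s, hs, hR⟩ := R
  obtain ⟨N, hN⟩ := exists_bound hs
  -- Two spare pairs above the support: at least one of them is not the pair of `x`.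
  set B : ℕ := N + 2
  let T : Pairs.{u} → Pairs.{u} → Prop := fun x y => (y.1 < B ∨ y.1 = x.1) ∧ R ![x, y]
  have hTperm (π : Equiv.Perm Pairs.{u}) (hπ : π ∈ pairGroup) (hfix : ∀ x, x.1 < B → π x = x)
      (x y : Pairs.{u}) : T (π x) (π y) ↔ T x y := by
    have h1 : (π y).1 < B ↔ y.1 < B :=
      ⟨fun h => by rwa [π.injective (hfix _ h)] at h, fun h => by rwa [hfix y h]⟩
    have h2 : ![π x, π y] = π ∘ ![x, y] := by
      funext k; fin_cases k <;> rfl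
    have h3 := hR π hπ (fun z hz => hfix z (by have := hN z hz; omega)) ![x, y]
    exact and_congr (or_congr h1 (hπ y x)) (by rw [h2]; exact h3)
  have hTex (x y : Pairs.{u}) (hxy : R ![x, y]) : ∃ z, T x z := by
    by_cases hy : y.1 < B ∨ y.1 = x.1
    · exact ⟨y, hy, hxy⟩
    · rw [not_or] at hy
      -- Exchanging the pair of `y` with the spare pair `k` fixes the support and `x`, and brings
      -- `y` below `B`.
      obtain ⟨k, hk₁, hk₂, hk₃⟩ : ∃ k, N ≤ k ∧ k < B ∧ k ≠ x.1 := by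
        by_cases h : x.1 = N
        · exact ⟨N + 1, by omega, by omega, by omega⟩
        · exact ⟨N, le_rfl, by omega, fun e => h e.symm⟩
      let π : Equiv.Perm Pairs.{u} := Equiv.prodCongr (Equiv.swap y.1 k) (Equiv.refl _)
      have hfix (z : Pairs.{u}) (h : z.1 ≠ y.1) (h' : z.1 ≠ k) : π z = z :=
        Prod.ext (Equiv.swap_apply_of_ne_of_ne h h') rfl
      have := (hR π (prodCongr_mem_pairGroup _) (fun z hz => hfix z
        (by have := hN z hz; omega) (by have := hN z hz; omega)) ![x, y]).2 hxy
      have e : π ∘ ![x, y] = ![x, π y] := by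
        funext i
        fin_cases i
        · exact hfix x (fun h => hy.2 h.symm) (Ne.symm hk₃)
        · rfl
      rw [e] at this
      refine ⟨π y, Or.inl ?_, this⟩
      simpa [π] using hk₂
  -- `S` selects the candidate of least rank; it is supported by the pairs below `B`.
  let S : (Fin 2 → Pairs.{u}) → Prop := fun v =>
    T (v 0) (v 1) ∧ ∀ z, T (v 0) z → rank B (v 0) (v 1) ≤ rank B (v 0) z
  have hS : S ∈ model.{u}.Pred 1 := by
    refine ⟨{x | x.1 < B}, ?_, ?_⟩
    · refine ((Set.finite_lt_nat B).prod (Set.finite_univ (α := ULift.{u} Bool))).subset ?_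
      exact fun x hx => ⟨hx, Set.mem_univ _⟩
    · intro π hπ hfix v
      refine and_congr (hTperm π hπ hfix _ _) ((π.forall_congr fun z => ?_).symm)
      simp only [Function.comp_apply, hTperm π hπ hfix, rank_perm hfix]
  refine ⟨⟨S, hS⟩, fun x y hxy => ?_⟩
  obtain ⟨z, hz, hmin⟩ := exists_minimalFor_of_wellFoundedLT (T x) (rank B x) (hTex x y hxy)
  have hmin' : ∀ w, T x w → rank B x z ≤ rank B x w := fun w hw => by
    by_contra hlt
    exact hlt (hmin hw (not_le.1 hlt).le)
  refine ⟨z, ⟨hz.2, hz, hmin'⟩, ?_⟩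
  rintro w ⟨-, hw, hwmin⟩
  exact rank_injOn B x hw.1 hz.1 (le_antisymm (hwmin z hz) (hmin' w hw))

/-! ### A Russell-type choice axiom fails -/

/-- "`C` is a class of the binary relation `E`", where `C` and `E` are the variables with
index `0`. -/
def isClass : Formula := .ex 2 (.all 3 (.iff (.app₁ 0 3) (.app₂ 0 2 3)))

theorem choiceStarAxiom_isClass_mem : choiceStarAxiom isClass 0 1 2 3 ∈ choiceStar1 := by
  refine ⟨isClass, 0, 1, 2, 3, ?_, ?_, by decide, ?_, ?_, ?_, rfl⟩ <;>
  simp [isClass, Formula.WellFormed, Formula.BindsInd, Formula.BindsPred, Formula.OccursPred,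
    Formula.app₁, Formula.app₂]

theorem model_not_valid_choiceStarAxiom :
    ¬ model.{u}.Valid (choiceStarAxiom isClass 0 1 2 3) := by
  let E : model.{u}.Pred 1 := ⟨fun v => (v 0).1 = (v 1).1, ∅, Set.finite_empty,
    fun π hπ _ v => hπ (v 0) (v 1)⟩
  -- Only the value `E` of the binary variable with index 0 matters; the other values are arbitrary.
  let f : Assignment model.{u} :=
    ⟨fun _ => (0, ⟨false⟩), fun n i =>
      if h : n = 1 then h ▸ E else ⟨_, (model.{u}.pred_nonempty n).some_mem⟩⟩
  have hfE : f.pred 1 0 = E := rfl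
  have hclass (g : Assignment model.{u}) (hg : g.pred 1 0 = E) (c : ℕ) :
      model.Sat g (isClass.substPred 0 0 c) ↔
        ∃ x : Pairs.{u}, ∀ z : Pairs.{u}, (g.pred 0 c).1 ![z] ↔ x.1 = z.1 := by
    have : isClass.substPred 0 0 c = .ex 2 (.all 3 (.iff (.app₁ c 3) (.app₂ 0 2 3))) := by
      simp [isClass, Formula.substPred, Formula.app₁, Formula.app₂]
    rw [this]
    simp only [Sat, sat_app₁, sat_app₂, Assignment.setInd_pred, hg, Assignment.setInd_ind]
    rfl
  -- Substituting the variable for itself lets `hclass` also treat the unsubstituted formula.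
  have hself : isClass.substPred 0 0 0 = isClass := by
    simp [isClass, Formula.substPred, Formula.app₁, Formula.app₂]
  intro hval
  obtain ⟨D, hD⟩ := hval f (by
    refine ⟨fun C hC => ?_, fun C₁ C₂ => ?_⟩
    · rw [← hself, hclass _ (by rw [Assignment.setPred_pred_of_ne _ _ (by simp), hfE])] at hC
      obtain ⟨x, hx⟩ := hC
      refine ⟨x, ?_⟩
      exact (sat_app₁ _ _ _).2 ((hx x).2 rfl)
    · set g := (f.setPred 0 1 C₁).setPred 0 2 C₂ with hg
      have hgE : g.pred 1 0 = E := by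
        rw [hg, Assignment.setPred_pred_of_ne _ _ (by simp),
          Assignment.setPred_pred_of_ne _ _ (by simp), hfE]
      have hg₁ : g.pred 0 1 = C₁ := by
        rw [hg, Assignment.setPred_pred_of_ne _ _ (by simp), Assignment.setPred_pred_self]
      have hg₂ : g.pred 0 2 = C₂ := by
        rw [hg, Assignment.setPred_pred_self]
      rintro ⟨⟨h₁, h₂⟩, hne⟩ ⟨y, hy₁, hy₂⟩
      rw [hclass g hgE, hg₁] at h₁
      rw [hclass g hgE, hg₂] at h₂
      rw [sat_app₁, Assignment.setInd_pred, Assignment.setInd_ind, if_pos rfl] at hy₁ hy₂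
      rw [hg₁] at hy₁
      rw [hg₂] at hy₂
      apply hne
      change g.pred 0 1 = g.pred 0 2
      rw [hg₁, hg₂]
      obtain ⟨x₁, hx₁⟩ := h₁
      obtain ⟨x₂, hx₂⟩ := h₂
      have hx : x₁.1 = x₂.1 := ((hx₁ y).1 hy₁).trans ((hx₂ y).1 hy₂).symm
      refine Subtype.ext (funext fun v => propext ?_)
      have hv : v = ![v 0] := by
        funext k; fin_cases k; rfl
      rw [hv]
      exact (hx₁ _).trans (by rw [hx]; exact (hx₂ _).symm))
  obtain ⟨s, hs, hDs⟩ := D.2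
  obtain ⟨N, hN⟩ := exists_bound hs
  -- The pair with index `N` lies outside the support of `D`, so swapping its elements preserves
  -- `D`.
  let C : model.{u}.Pred 0 := ⟨fun v => N = (v 0).1, {x | x.1 = N}, by
    refine ((Set.finite_singleton N).prod (Set.finite_univ (α := ULift.{u} Bool))).subset ?_
    exact fun x hx => ⟨hx, Set.mem_univ _⟩, .of_imp fun π _ hfix v hv => by
      rw [Function.comp_apply, hfix _ hv.symm]
      exact hv⟩
  have hC := hD C (by
    rw [← hself, hclass _ (by rw [Assignment.setPred_pred_of_ne _ _ (by simp),
      Assignment.setPred_pred_of_ne _ _ (by simp), hfE]), Assignment.setPred_pred_self]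
    exact ⟨(N, ⟨false⟩), fun z => Iff.rfl⟩)
  have hD3 : ((f.setPred 0 3 D).setPred 0 0 C).pred 0 3 = D := by
    rw [Assignment.setPred_pred_of_ne _ _ (by simp), Assignment.setPred_pred_self]
  rw [sat_exUnique (P := fun y => C.1 ![y] ∧ D.1 ![y]) (by decide)
    (fun g hp _ => by
      simp only [Sat, sat_app₁, hp, Assignment.setPred_pred_self, hD3])
    (fun g hp _ => by
      simp only [Sat, sat_app₁, hp, Assignment.setPred_pred_self, hD3])] at hC
  obtain ⟨y, ⟨hyC, hyD⟩, huniq⟩ := hC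
  have hyN : y.1 = N := hyC.symm
  refine swapPair_ne hyN (huniq (swapPair N y) ⟨?_, ?_⟩)
  · change N = (swapPair N y).1
    exact (hyN.symm.trans (swapPair_fst N y).symm)
  · have := (hDs (swapPair N) (swapPair_mem_pairGroup N)
      (fun x hx => swapPair_of_ne (hN x hx).ne) ![y]).2 hyD
    have e : swapPair N ∘ ![y] = ![swapPair N y] := by
      funext k; fin_cases k; rfl
    rwa [e] at this

end Pairs

end HPL

theorem theorem4 : HPL.Independent.{u} HPL.choiceStar1 {HPL.AC11} := by
  constructor
  · intro h
    refine HPL.Pairs.model_not_valid_choiceStarAxiom.{u}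
      (h _ HPL.Pairs.choiceStarAxiom_isClass_mem _ HPL.PredStructure.isHenkin_symmetric ?_)
    rintro _ rfl
    exact HPL.Pairs.model_valid_AC11
  · intro h
    -- Any non-empty domain would do here.
    refine h (HPL.PredStructure.standard (ULift.{u} ℕ)) (HPL.PredStructure.isHenkin_standard _) ?_
      (HPL.PredStructure.standard_models_choiceStar1 _)
    rintro _ rfl
    exact HPL.PredStructure.standard_valid_AC11 _
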